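/- **Setting.** A dynamic rooted forest lives on a fixed set of $n$ vertices and starts with no edges. Every tree has a fixed root. An insertion $(p,r)$ is allowed if $r$ is the root of its tree and $p$ lies in another tree; then $r$ becomes a child of $p$. Any edge between a vertex $r$ and its parent $p$ may be deleted; then $r$ becomes the root of a new tree. At every time, all degrees are at most $\Delta$. The recourse of an update is the number of edges, present before and after the update, whose color changes; the amortized recourse on an update sequence is the total recourse divided by the number of updates. For a coloring of some of the edges, let $A(v)$ be the set of colors not used on the edges incident to $v$. The algorithm ColorfulPath uses the palette $\{1,\dots,2\Delta-2\}$. On a deletion it keeps the colors of the remaining edges. On an insertion $(p,r)$ it adds the edge, uncolored, and calls $\mathrm{Step}(p,r)$, where $\mathrm{Step}(u,v)$, for an uncolored edge $(u,v)$ with $u$ the parent of $v$, is as follows. 1. If $A(u)\cap A(v)\neq\emptyset$, color $(u,v)$ with any color of $A(u)\cap A(v)$ and stop. 2. Otherwise, if $v$ has a child $w$ such that the color of $(v,w)$ is in $A(u)$ and $A(v)\cap A(w)\ne\emptyset$, choose any such $w$; give the color of $(v,w)$ to $(u,v)$, uncolor $(v,w)$ and call $\mathrm{Step}(v,w)$.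 3. Otherwise choose any child $w$ of $v$ such that the color of $(v,w)$ differs from the color of the edge between the grandparent and the parent of $u$ (any child $w$, if there is no such edge); give the color of $(v,w)$ to $(u,v)$, uncolor $(v,w)$ and call $\mathrm{Step}(v,w)$. **Theorem.** (a) There is an absolute constant $C$ such that for every $\Delta\ge 3$, every $n$, every update sequence as above of length $T$ on $n$ vertices, and all outcomes of the arbitrary choices, ColorfulPath handles every update in finitely many steps without getting stuck, has after every update a proper edge coloring of the current forest with $2\Delta-2$ colors, and has total recourse at most $C\cdot T$; that is, its amortized recourse is $O(1)$. (b) This is optimal up to a constant factor: for every $\Delta\ge3$ there is $n_0=n_0(\Delta)$ such that for every $n\ge n_0$, every deterministic algorithm that maintains a proper $(2\Delta-2)$-edge-coloring of dynamic rooted forests on $n$ vertices with maximum degree at most $\Delta$, and every $\epsilon>0$, there are arbitrarily long update sequences on which the amortized recourse of the algorithm is greater than $\frac12-\epsilon$. -/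

import Mathlib

/-- A rooted forest on the vertex set `V`, given by its parent pointers: `parent v = none` says
that `v` is the root of its tree. No vertex is a proper ancestor of itself. -/
@[ext]
structure RootedForest (V : Type*) where
  parent : V → Option V
  acyclic : ∀ v, ¬ Relation.TransGen (fun a b => parent a = some b) v v

/-- An update: the insertion of the edge `(p, r)` that makes `r` a child of `p`, or the deletion
of the edge `(p, r)` between `r` and its parent `p`. -/
inductive ForestUpdate (V : Type*) where
  | insert (p r : V)
  | delete (p r : V)

/-- The sequence of the updates made so far, most recent first. -/
abbrev UpdateHistory (V : Type*) := List (ForestUpdate V)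

/-- A partial coloring of edges by the palette `Fin κ`; `none` means uncolored. -/
abbrev PartialColoring (V : Type*) (κ : ℕ) := Sym2 V → Option (Fin κ)

namespace RootedForest

variable {V : Type*}

/-- The forest without edges: every vertex is a root. -/
def empty (V : Type*) : RootedForest V where
  parent := fun _ => none
  acyclic := by
    intro v h
    obtain ⟨_, h, _⟩ := Relation.TransGen.head'_iff.1 h
    exact absurd h (by simp)

/-- `F.Below v a`: the vertex `a` is `v` or an ancestor of `v`. -/
def Below (F : RootedForest V) (v a : V) : Prop :=
  Relation.ReflTransGen (fun a b => F.parent a = some b) v a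

/-- The underlying undirected graph. -/
def graph (F : RootedForest V) : SimpleGraph V where
  Adj u v := F.parent u = some v ∨ F.parent v = some u
  symm := ⟨fun _ _ h => h.symm⟩
  loopless := ⟨fun v h => F.acyclic v (Relation.TransGen.single (h.elim id id))⟩

/-- Every vertex has degree at most `Δ`. -/
def DegreeLE (F : RootedForest V) (Δ : ℕ) : Prop :=
  ∀ v, (F.graph.neighborSet v).encard ≤ Δ

theorem acyclic_insert [DecidableEq V] (F : RootedForest V) (p r : V) (h : ¬ F.Below p r) (v : V) :
    ¬ Relation.TransGen (fun a b => Function.update F.parent r (some p) a = some b) v v := by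
  have key : ∀ a b,
      Relation.TransGen (fun a b => Function.update F.parent r (some p) a = some b) a b →
      Relation.TransGen (fun a b => F.parent a = some b) a b ∨ (F.Below a r ∧ F.Below p b) := by
    intro a b hab
    induction hab with
    | @single b hb =>
      by_cases har : a = r
      · subst har
        simp only [Function.update_self, Option.some.injEq] at hb
        subst hb
        exact Or.inr ⟨Relation.ReflTransGen.refl, Relation.ReflTransGen.refl⟩
      · rw [Function.update_of_ne har] at hb
        exact Or.inl (Relation.TransGen.single hb)
    | @tail b c _ hbc ih =>
      by_cases hbr : b = r
      · subst hbr
        simp only [Function.update_self, Option.some.injEq] at hbc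
        subst hbc
        refine Or.inr ⟨?_, Relation.ReflTransGen.refl⟩
        rcases ih with ih | ih
        · exact ih.to_reflTransGen
        · exact ih.1
      · rw [Function.update_of_ne hbr] at hbc
        rcases ih with ih | ih
        · exact Or.inl (ih.tail hbc)
        · exact Or.inr ⟨ih.1, Relation.ReflTransGen.tail ih.2 hbc⟩
  intro hv
  rcases key v v hv with h1 | h1
  · exact F.acyclic v h1
  · exact h (Relation.ReflTransGen.trans h1.2 h1.1)

theorem acyclic_delete [DecidableEq V] (F : RootedForest V) (r v : V) :
    ¬ Relation.TransGen (fun a b => Function.update F.parent r none a = some b) v v := by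
  intro hv
  refine F.acyclic v (Relation.TransGen.mono ?_ _ _ hv)
  intro a b hab
  by_cases har : a = r
  · subst har
    simp at hab
  · simpa [Function.update_of_ne har] using hab

/-- `(p, r)` may be inserted: `r` is the root of its tree, and `p` lies in another tree. -/
def CanInsert (F : RootedForest V) (p r : V) : Prop :=
  F.parent r = none ∧ ¬ F.Below p r

open Classical in
/-- The forest after an update. After the deletion of `(p, r)` the vertex `r` is the root of a new
tree. (An update that cannot be made leaves the forest as it is; see `Legal`.) -/
noncomputable def update [DecidableEq V] (F : RootedForest V) : ForestUpdate V → RootedForest V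
  | .insert p r =>
    if h : F.CanInsert p r then
      { parent := Function.update F.parent r (some p)
        acyclic := F.acyclic_insert p r h.2 }
    else F
  | .delete p r =>
    if F.parent r = some p then
      { parent := Function.update F.parent r none
        acyclic := F.acyclic_delete r }
    else F

/-- The updates that may be made to `F` when the maximum degree has to stay at most `Δ`. -/
def Legal [DecidableEq V] (Δ : ℕ) (F : RootedForest V) : ForestUpdate V → Prop
  | .insert p r => F.CanInsert p r ∧ (F.update (.insert p r)).DegreeLE Δ
  | .delete p r => F.parent r = some p

/-- The forest after a sequence of updates that starts from the forest without edges. -/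
noncomputable def after [DecidableEq V] : UpdateHistory V → RootedForest V
  | [] => empty V
  | x :: h => (after h).update x

/-- Every update of the sequence is legal at the time when it is made. -/
def LegalHistory [DecidableEq V] (Δ : ℕ) : UpdateHistory V → Prop
  | [] => True
  | x :: h => LegalHistory Δ h ∧ Legal Δ (after h) x

section Coloring

variable {κ : ℕ}

/-- `c` is a proper edge coloring of `F` (all edges are colored). -/
def IsProper (F : RootedForest V) (c : PartialColoring V κ) : Prop :=
  (∀ e ∈ F.graph.edgeSet, c e ≠ none) ∧
    ∀ u v w, F.graph.Adj u v → F.graph.Adj u w → v ≠ w → c s(u, v) ≠ c s(u, w)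

/-- `A(v)`: the colors that no edge incident to `v` has. -/
def available (F : RootedForest V) (c : PartialColoring V κ) (v : V) : Set (Fin κ) :=
  {α | ∀ w, F.graph.Adj v w → c s(v, w) ≠ some α}

/-- The color of the edge between the grandparent and the parent of `u`; `none` if there is no
such edge. -/
def grandColor (F : RootedForest V) (c : PartialColoring V κ) (u : V) : Option (Fin κ) :=
  (F.parent u).bind fun q => (F.parent q).bind fun g => c s(g, q)

/-- The recourse of one update that changes the forest from `F` to `F'` and the coloring from `c`
to `c'`: the number of edges, present before and after, whose color changes. -/
noncomputable def recourse (F F' : RootedForest V) (c c' : PartialColoring V κ) : ℕ :=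
  {e | e ∈ F.graph.edgeSet ∧ e ∈ F'.graph.edgeSet ∧ c e ≠ c' e}.ncard

end Coloring

end RootedForest

namespace ColorfulPath

variable {V : Type*} {κ : ℕ}

/-- A configuration of the recoloring procedure: a pending call of the recursive step on the
uncolored edge `(u, v)` with entry vertex `u`, or the end of the procedure. -/
inductive Config (V : Type*) (κ : ℕ) where
  | call (c : PartialColoring V κ) (u v : V)
  | done (c : PartialColoring V κ)

/-- `w` is a child of `v`, the edge `(v, w)` has the color `α`, which is available at `u`, and some
color is available for the edge `(v, w)`. -/
def LookAhead (F : RootedForest V) (c : PartialColoring V κ) (u v w : V) (α : Fin κ) : Prop :=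
  F.parent w = some v ∧ c s(v, w) = some α ∧ α ∈ F.available c u ∧
    (F.available c w ∩ F.available c v).Nonempty

/-- Color the edge `(u, v)` by `α` and uncolor the edge `(v, w)`. -/
def shift [DecidableEq V] (c : PartialColoring V κ) (u v w : V) (α : Fin κ) :
    PartialColoring V κ :=
  Function.update (Function.update c s(u, v) (some α)) s(v, w) none

/-- One recursive step in the forest `F`. The arbitrary choices of the algorithm make it a
relation. -/
inductive Step [DecidableEq V] (F : RootedForest V) : Config V κ → Config V κ → Prop
  /-- A color is available for `(u, v)`: use any such color and stop. -/
  | finish {c : PartialColoring V κ} {u v : V} {α : Fin κ}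
      (hα : α ∈ F.available c u ∩ F.available c v) :
      Step F (.call c u v) (.done (Function.update c s(u, v) (some α)))
  /-- Otherwise, move to an edge `(v, w)` for which a color is available, if there is one. -/
  | lookAhead {c : PartialColoring V κ} {u v w : V} {α : Fin κ}
      (huv : F.available c u ∩ F.available c v = ∅)
      (hw : LookAhead F c u v w α) :
      Step F (.call c u v) (.call (shift c u v w α) v w)
  /-- Otherwise, move to any child edge `(v, w)` of `v` whose color is not that of the edge between
  the grandparent and the parent of `u`. -/
  | descend {c : PartialColoring V κ} {u v w : V} {α : Fin κ}
      (huv : F.available c u ∩ F.available c v = ∅)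
      (hno : ∀ w' α', ¬ LookAhead F c u v w' α')
      (hw : F.parent w = some v) (hα : c s(v, w) = some α)
      (hne : F.grandColor c u ≠ some α) :
      Step F (.call c u v) (.call (shift c u v w α) v w)

/-- The configuration from which the update `x` is handled when the coloring is `c`: a new edge is
uncolored and the recursive step is called on it, entering from the parent; a deletion keeps the
colors of the other edges. -/
def start [DecidableEq V] (c : PartialColoring V κ) : ForestUpdate V → Config V κ
  | .insert p r => .call (Function.update c s(p, r) none) p r
  | .delete p r => .done (Function.update c s(p, r) none)

/-- `Run Δ h c R`: on the legal update sequence `h`, with some outcome of the arbitrary choices,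
the algorithm with the palette `Fin (2 * Δ - 2)` ends with the coloring `c` and has had the total
recourse `R`. -/
inductive Run [DecidableEq V] (Δ : ℕ) :
    UpdateHistory V → PartialColoring V (2 * Δ - 2) → ℕ → Prop
  | nil : Run Δ [] (fun _ => none) 0
  | cons {h : UpdateHistory V} {c c' : PartialColoring V (2 * Δ - 2)} {R : ℕ} {x : ForestUpdate V}
      (hrun : Run Δ h c R) (hx : RootedForest.Legal Δ (RootedForest.after h) x)
      (hstep : Relation.ReflTransGen (Step (RootedForest.after (x :: h))) (start c x) (.done c')) :
      Run Δ (x :: h) c'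
        (R + RootedForest.recourse (RootedForest.after h) (RootedForest.after (x :: h)) c c')

/-- Whatever the arbitrary choices are, the handling of the update `x` terminates, and it does not
get stuck before it is done. -/
def Terminates [DecidableEq V] (F : RootedForest V) (c : PartialColoring V κ)
    (x : ForestUpdate V) : Prop :=
  Acc (fun s t : Config V κ => Step F t s) (start c x) ∧
    ∀ s, Relation.ReflTransGen (Step F) (start c x) s → (∀ t, ¬ Step F s t) → ∃ c', s = .done c'

end ColorfulPath

/-- A deterministic algorithm for the dynamic edge coloring of rooted forests: it maps every
sequence of updates to the coloring that it holds after this sequence. -/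
abbrev DynamicColoringAlgorithm (V : Type*) (κ : ℕ) := UpdateHistory V → PartialColoring V κ

namespace DynamicColoringAlgorithm

variable {V : Type*} [DecidableEq V] {κ : ℕ}

/-- The algorithm maintains a proper edge coloring of the rooted forest on every update sequence
that keeps the maximum degree at most `Δ`. -/
def Maintains (Δ : ℕ) (A : DynamicColoringAlgorithm V κ) : Prop :=
  ∀ h, RootedForest.LegalHistory Δ h → (RootedForest.after h).IsProper (A h)

/-- The total recourse of the algorithm on an update sequence. -/
noncomputable def totalRecourse (A : DynamicColoringAlgorithm V κ) : UpdateHistory V → ℕ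
  | [] => 0
  | x :: h => totalRecourse A h +
      RootedForest.recourse (RootedForest.after h) (RootedForest.after (x :: h)) (A h) (A (x :: h))

end DynamicColoringAlgorithm

/-!
**Upper bound.** The ends `u`, `v` of the only uncolored edge see at most `Δ - 1` colors each, out of
`2 * Δ - 2`. So if the edge cannot be colored, they see complementary sets of exactly `Δ - 1` colors
(`Pending.blocked`); in particular every color of a child edge of `v` may be moved to `(u, v)`, and
there are at least two of them, so that the procedure never gets stuck. It moves down the tree and
therefore terminates. If in addition no child edge can be freed by looking ahead, then the child
edges of every child of `v` have precisely the colors that the child edges of `v` lack: `v` is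
`Locked` (`Pending.childColors_eq`). A blind step from `v` to its child `w` is always followed by
another shift, which gives `(v, w)` the color of a child edge of `w`. As this color also occurs
below the other children of `v`, the vertex `v` is no longer locked (`RunSpec.descend`). Hence all
but one of the recolored edges are paid for by vertices that cease to be locked, while at most three
vertices become locked, and with the number of locked vertices as potential the amortized recourse
is at most 4 (`Run.bound`).

**Lower bound.** Let `d = Δ - 1`. The adversary owns many stars with `d` legs, and one isolated
vertex, the post of `S`, for every set `S` of colors. A star whose legs have the color set `S` may be
hung on the post of `S`. It is spoiled when its leg colors change, and the adversary takes spoiled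
stars down at once. Unspoiled stars at the post of `S` are attached by edges with distinct colors
outside `S`, so there are at most `d` of them; with sufficiently many stars a free one is always
left, and the adversary can continue forever. The number of hanging stars is bounded, so about half
of the updates are deletions, and each deletion takes down a star that has been spoiled by a
recoloring of its own. Formally, twice the recourse plus the number of hanging stars minus twice the
number of spoiled ones grows by at least one with every update (`exists_update`).
-/

namespace RootedForest

/-! ### Rooted forests -/

section Forest

variable {V : Type*} (F : RootedForest V)

theorem wellFounded_child [Finite V] : WellFounded fun w v => F.parent w = some v := by
  have : IsTrans V (Relation.TransGen fun a b => F.parent a = some b) :=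
    ⟨fun _ _ _ => Relation.TransGen.trans⟩
  have : Std.Irrefl (Relation.TransGen fun a b => F.parent a = some b) := ⟨F.acyclic⟩
  exact Subrelation.wf (r := Relation.TransGen fun a b => F.parent a = some b)
    (fun h => Relation.TransGen.single h)
    (Finite.wellFounded_of_trans_of_irrefl (Relation.TransGen fun a b => F.parent a = some b))

variable {F}

theorem not_below_of_parent {v w : V} (h : F.parent w = some v) : ¬ F.Below v w :=
  fun hb => F.acyclic w (Relation.TransGen.head' h hb)

theorem ne_of_parent {v w : V} (h : F.parent w = some v) : w ≠ v := by
  rintro rfl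
  exact not_below_of_parent h Relation.ReflTransGen.refl

theorem not_below_of_parent_parent {u v w : V} (hv : F.parent v = some u)
    (hw : F.parent w = some v) : ¬ F.Below u w :=
  fun hb => not_below_of_parent hw (Relation.ReflTransGen.head hv hb)

theorem ne_of_parent_parent {u v w : V} (hv : F.parent v = some u) (hw : F.parent w = some v) :
    w ≠ u := by
  rintro rfl
  exact not_below_of_parent_parent hv hw Relation.ReflTransGen.refl

/-- An undirected edge determines which of its ends is the parent. -/
theorem eq_of_sym2_eq {a b x y : V} (hb : F.parent b = some a) (hy : F.parent y = some x)
    (h : s(a, b) = s(x, y)) : a = x ∧ b = y := by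
  rcases Sym2.eq_iff.1 h with h | ⟨rfl, rfl⟩
  · exact h
  · exact absurd rfl (ne_of_parent_parent hb hy)

theorem mem_edgeSet_iff {e : Sym2 V} :
    e ∈ F.graph.edgeSet ↔ ∃ a b, F.parent b = some a ∧ e = s(a, b) := by
  induction e with
  | _ x y =>
    rw [SimpleGraph.mem_edgeSet]
    constructor
    · rintro (h | h)
      · exact ⟨y, x, h, Sym2.eq_swap⟩
      · exact ⟨x, y, h, rfl⟩
    · rintro ⟨a, b, h, he⟩
      rcases Sym2.eq_iff.1 he with ⟨rfl, rfl⟩ | ⟨rfl, rfl⟩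
      · exact Or.inr h
      · exact Or.inl h

theorem not_adj_of_canInsert {p r : V} (h : F.CanInsert p r) : ¬ F.graph.Adj p r := by
  rintro (hp | hr)
  · exact h.2 (Relation.ReflTransGen.single hp)
  · rw [h.1] at hr
    cases hr

variable [DecidableEq V]

theorem parent_insert_iff {p r : V} (h : F.CanInsert p r) {x y : V} :
    (F.update (.insert p r)).parent y = some x ↔ F.parent y = some x ∨ (x = p ∧ y = r) := by
  have hpar : (F.update (.insert p r)).parent = Function.update F.parent r (some p) := by
    simp [update, h]
  rw [hpar]
  by_cases hy : y = r
  · subst hy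
    simp [h.1, eq_comm]
  · simp [hy]

theorem parent_delete_iff {p r : V} (h : F.parent r = some p) {x y : V} :
    (F.update (.delete p r)).parent y = some x ↔ F.parent y = some x ∧ y ≠ r := by
  have hpar : (F.update (.delete p r)).parent = Function.update F.parent r none := by
    simp [update, h]
  rw [hpar]
  by_cases hy : y = r
  · simp [hy]
  · simp [hy]

end Forest

/-! ### Colors of child edges -/

section Colors

variable {V : Type*} {κ : ℕ} {F : RootedForest V} {c c' : PartialColoring V κ}

/-- The colors of the edges between `v` and its children. -/
def childColors (F : RootedForest V) (c : PartialColoring V κ) (v : V) : Set (Fin κ) :=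
  {α | ∃ w, F.parent w = some v ∧ c s(v, w) = some α}

/-- The vertex `v` has children, and at each of them the child edges have exactly the colors that
the child edges of `v` do not have. Only at such vertices can the recoloring procedure be forced to
continue blindly. -/
def Locked (F : RootedForest V) (c : PartialColoring V κ) (v : V) : Prop :=
  (∃ w, F.parent w = some v) ∧
    ∀ w, F.parent w = some v → F.childColors c w = (F.childColors c v)ᶜ

theorem childColors_congr {v : V}
    (h : ∀ w, F.parent w = some v → c s(v, w) = c' s(v, w)) :
    F.childColors c v = F.childColors c' v := by
  ext α
  refine exists_congr fun w => and_congr_right fun hw => ?_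
  rw [h w hw]

/-- Whether `x` is locked depends only on the child colors of `x` and of its children. -/
theorem locked_iff_of_childColors_eq {Z : Set V} {x : V}
    (h : ∀ y ∉ Z, F.childColors c y = F.childColors c' y) (hx : x ∉ Z)
    (hZ : ∀ z ∈ Z, F.parent z ≠ some x) : F.Locked c x ↔ F.Locked c' x := by
  refine and_congr_right fun _ => forall_congr' fun w => forall_congr' fun hw => ?_
  rw [h x hx, h w fun hwZ => hZ w hwZ hw]

theorem childColors_update [DecidableEq V] {u v y : V} (hv : F.parent v = some u) (hy : y ≠ u)
    (o : Option (Fin κ)) :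
    F.childColors (Function.update c s(u, v) o) y = F.childColors c y := by
  refine childColors_congr fun w hw => Function.update_of_ne (fun h => hy ?_) _ _
  exact (eq_of_sym2_eq hw hv h).1

/-- The edges at `x` other than the one to a given neighbor `y` have at most `Δ - 1` colors. -/
theorem ncard_colors_le {Δ : ℕ} (hdeg : F.DegreeLE Δ) {x y : V} (hxy : F.graph.Adj x y) :
    {α | ∃ z, z ≠ y ∧ F.graph.Adj x z ∧ c s(x, z) = some α}.ncard ≤ Δ - 1 := by
  have hfin : (F.graph.neighborSet x).Finite :=
    Set.finite_of_encard_le_coe (hdeg x)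
  have hcard : (F.graph.neighborSet x).ncard ≤ Δ := by
    have := hdeg x
    rw [← hfin.cast_ncard_eq] at this
    exact_mod_cast this
  calc _ = (some '' {α | ∃ z, z ≠ y ∧ F.graph.Adj x z ∧ c s(x, z) = some α}).ncard :=
        (Set.ncard_image_of_injective _ (Option.some_injective _)).symm
    _ ≤ ((fun z => c s(x, z)) '' (F.graph.neighborSet x \ {y})).ncard := by
        refine Set.ncard_le_ncard ?_ (hfin.sdiff.image _)
        rintro _ ⟨α, ⟨z, hz, hadj, hc⟩, rfl⟩
        exact ⟨z, ⟨hadj, hz⟩, hc⟩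
    _ ≤ (F.graph.neighborSet x \ {y}).ncard := Set.ncard_image_le hfin.sdiff
    _ = (F.graph.neighborSet x).ncard - 1 := Set.ncard_sdiff_singleton_of_mem hxy
    _ ≤ Δ - 1 := Nat.sub_le_sub_right hcard 1

theorem ncard_childColors_le {Δ : ℕ} (hdeg : F.DegreeLE Δ) {v w : V} (hw : F.parent w = some v) :
    (F.childColors c w).ncard ≤ Δ - 1 := by
  refine (Set.ncard_le_ncard ?_ (Set.toFinite _)).trans
    (ncard_colors_le (c := c) hdeg (show F.graph.Adj w v from Or.inl hw))
  rintro α ⟨z, hz, hc⟩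
  exact ⟨z, ne_of_parent_parent hw hz, Or.inr hz, hc⟩

end Colors

end RootedForest

/-! ### Pending calls of the recursive step -/

namespace ColorfulPath

open RootedForest

variable {V : Type*} {F : RootedForest V}

/-- The invariant of a call of the recursive step on `(u, v)`: this edge, with parent `u`, is the
only uncolored edge, and edges with a common end have different values. -/
structure Pending {κ : ℕ} (F : RootedForest V) (c : PartialColoring V κ) (u v : V) : Prop where
  parent : F.parent v = some u
  uncolored : c s(u, v) = none
  colored : ∀ e ∈ F.graph.edgeSet, e ≠ s(u, v) → c e ≠ none
  proper : ∀ x y z, F.graph.Adj x y → F.graph.Adj x z → y ≠ z → c s(x, y) ≠ c s(x, z)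

namespace Pending

section

variable {κ : ℕ} {c : PartialColoring V κ} {u v : V}

theorem exists_color (h : Pending F c u v) {w : V} (hw : F.parent w = some v) :
    ∃ α, c s(v, w) = some α := by
  refine Option.ne_none_iff_exists'.1 (h.colored _ (mem_edgeSet_iff.2 ⟨v, w, hw, rfl⟩) ?_)
  exact fun he => ne_of_parent h.parent (eq_of_sym2_eq hw h.parent he).1

theorem compl_available_eq (h : Pending F c u v) :
    (F.available c v)ᶜ = F.childColors c v := by
  ext α
  simp only [available, Set.mem_compl_iff, Set.mem_ofPred_eq, not_forall, not_not, childColors]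
  constructor
  · rintro ⟨w, hw | hw, hc⟩
    · obtain rfl : u = w := Option.some_injective _ (h.parent.symm.trans hw)
      rw [Sym2.eq_swap, h.uncolored] at hc
      cases hc
    · exact ⟨w, hw, hc⟩
  · rintro ⟨w, hw, hc⟩
    exact ⟨w, Or.inr hw, hc⟩

theorem isProper_update [DecidableEq V] (h : Pending F c u v) {α : Fin κ}
    (hα : α ∈ F.available c u ∩ F.available c v) :
    F.IsProper (Function.update c s(u, v) (some α)) := by
  have key : ∀ x y z, F.graph.Adj x z → s(x, y) = s(u, v) → c s(x, z) ≠ some α := by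
    intro x y z hz he
    rcases Sym2.eq_iff.1 he with ⟨rfl, rfl⟩ | ⟨rfl, rfl⟩
    · exact hα.1 z hz
    · exact hα.2 z hz
  refine ⟨fun e he => ?_, fun x y z hy hz hyz => ?_⟩
  · by_cases h1 : e = s(u, v)
    · simp [h1]
    · rw [Function.update_of_ne h1]
      exact h.colored e he h1
  · by_cases h1 : s(x, y) = s(u, v)
    · have h2 : s(x, z) ≠ s(u, v) := fun h2 => hyz (Sym2.congr_right.1 (h1.trans h2.symm))
      rw [h1, Function.update_self, Function.update_of_ne h2]
      exact (key x y z hz h1).symm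
    · rw [Function.update_of_ne h1]
      by_cases h2 : s(x, z) = s(u, v)
      · rw [h2, Function.update_self]
        exact key x z y hy h2
      · rw [Function.update_of_ne h2]
        exact h.proper x y z hy hz hyz

theorem shift [DecidableEq V] (h : Pending F c u v) {w : V} {α : Fin κ}
    (hw : F.parent w = some v) (hα : c s(v, w) = some α) (hu : α ∈ F.available c u) :
    Pending F (shift c u v w α) v w := by
  have hne : s(u, v) ≠ s(v, w) := fun he =>
    ne_of_parent h.parent (eq_of_sym2_eq h.parent hw he).1.symm
  have key : ∀ x y z, F.graph.Adj x z → y ≠ z → s(x, y) = s(u, v) → s(x, z) ≠ s(v, w) →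
      c s(x, z) ≠ some α := by
    intro x y z hz hyz he hzw
    rcases Sym2.eq_iff.1 he with ⟨rfl, rfl⟩ | ⟨rfl, rfl⟩
    · exact hu z hz
    · rw [← hα]
      refine h.proper x z w hz (Or.inr hw) ?_
      rintro rfl
      exact hzw rfl
  have hcol : ∀ e ∈ F.graph.edgeSet, e ≠ s(v, w) → ColorfulPath.shift c u v w α e ≠ none := by
    intro e he h1
    rw [ColorfulPath.shift, Function.update_of_ne h1]
    by_cases h2 : e = s(u, v)
    · simp [h2]
    · rw [Function.update_of_ne h2]
      exact h.colored e he h2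
  refine ⟨hw, by simp [ColorfulPath.shift], hcol, fun x y z hy hz hyz => ?_⟩
  by_cases h1 : s(x, y) = s(v, w)
  · have h2 : s(x, z) ≠ s(v, w) := fun h2 => hyz (Sym2.congr_right.1 (h1.trans h2.symm))
    have h3 := hcol s(x, z) hz h2
    rw [h1]
    simpa [ColorfulPath.shift] using h3.symm
  by_cases h2 : s(x, z) = s(v, w)
  · have h3 := hcol s(x, y) hy h1
    rw [h2]
    simpa [ColorfulPath.shift] using h3
  rw [ColorfulPath.shift, Function.update_of_ne h1, Function.update_of_ne h2]
  by_cases h3 : s(x, y) = s(u, v)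
  · have h4 : s(x, z) ≠ s(u, v) := fun h4 => hyz (Sym2.congr_right.1 (h3.trans h4.symm))
    rw [h3, Function.update_self, Function.update_of_ne h4]
    exact (key x y z hz hyz h3 h2).symm
  · rw [Function.update_of_ne h3]
    by_cases h4 : s(x, z) = s(u, v)
    · rw [h4, Function.update_self]
      exact key x z y hy hyz.symm h4 h1
    · rw [Function.update_of_ne h4]
      exact h.proper x y z hy hz hyz

theorem shift_childColors [DecidableEq V] (h : Pending F c u v) {w y : V} {α : Fin κ}
    (hw : F.parent w = some v) (hu : y ≠ u) (hv : y ≠ v) :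
    F.childColors (ColorfulPath.shift c u v w α) y = F.childColors c y := by
  rw [ColorfulPath.shift, childColors_update hw hv, childColors_update h.parent hu]

end

section Blocked

variable {Δ : ℕ} {c : PartialColoring V (2 * Δ - 2)} {u v : V}

/-- Each end of the uncolored edge sees at most `Δ - 1` of the `2 * Δ - 2` colors. If the edge
cannot be colored, the two ends therefore see complementary sets of exactly `Δ - 1` colors. -/
theorem blocked (h : Pending F c u v) (hdeg : F.DegreeLE Δ)
    (hb : F.available c u ∩ F.available c v = ∅) :
    (F.childColors c v).ncard = Δ - 1 ∧ F.childColors c v = F.available c u := by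
  have hu : ((F.available c u)ᶜ).ncard ≤ Δ - 1 := by
    refine (Set.ncard_le_ncard ?_ (Set.toFinite _)).trans
      (ncard_colors_le (c := c) hdeg (show F.graph.Adj u v from Or.inr h.parent))
    intro α hα
    simp only [available, Set.mem_compl_iff, Set.mem_ofPred_eq, not_forall, not_not] at hα
    obtain ⟨w, hw, hc⟩ := hα
    refine ⟨w, ?_, hw, hc⟩
    rintro rfl
    rw [h.uncolored] at hc
    cases hc
  have hsub : F.available c u ⊆ F.childColors c v := by
    rw [← h.compl_available_eq]
    exact fun α h1 h2 => (Set.ext_iff.1 hb α).1 ⟨h1, h2⟩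
  have hle := ncard_childColors_le (c := c) hdeg h.parent
  have hsum := Set.ncard_add_ncard_compl (F.available c u)
  rw [Nat.card_eq_fintype_card, Fintype.card_fin] at hsum
  have hmono := Set.ncard_le_ncard hsub (Set.toFinite _)
  exact ⟨by omega, (Set.eq_of_subset_of_ncard_le hsub (by omega) (Set.toFinite _)).symm⟩

/-- The colors at a child of `v` when neither `(u, v)` nor, after a shift, the edge to this child
can be colored. -/
theorem childColors_eq (h : Pending F c u v) (hdeg : F.DegreeLE Δ)
    (hb : F.available c u ∩ F.available c v = ∅) (hno : ∀ w α, ¬ LookAhead F c u v w α)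
    {w : V} (hw : F.parent w = some v) : F.childColors c w = (F.childColors c v)ᶜ := by
  obtain ⟨hcard, hav⟩ := h.blocked hdeg hb
  obtain ⟨α, hα⟩ := h.exists_color hw
  have hαv : α ∈ F.childColors c v := ⟨w, hw, hα⟩
  have hsub : (F.childColors c v)ᶜ ⊆ F.childColors c w := by
    intro β hβ
    by_contra hβw
    refine hno w α ⟨hw, hα, hav ▸ hαv, β, ?_, ?_⟩
    · rintro z (hz | hz) hc
      · obtain rfl : v = z := Option.some_injective _ (hw.symm.trans hz)
        rw [Sym2.eq_swap] at hc
        exact hβ ⟨w, hw, hc⟩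
      · exact hβw ⟨z, hz, hc⟩
    · rw [← h.compl_available_eq, compl_compl] at hβ
      exact hβ
  have hle := ncard_childColors_le (c := c) hdeg hw
  have hsum := Set.ncard_add_ncard_compl (F.childColors c v)
  rw [Nat.card_eq_fintype_card, Fintype.card_fin] at hsum
  exact (Set.eq_of_subset_of_ncard_le hsub (by omega) (Set.toFinite _)).symm

theorem exists_child_ne (h : Pending F c u v) (hdeg : F.DegreeLE Δ) (hΔ : 3 ≤ Δ)
    (hb : F.available c u ∩ F.available c v = ∅) (o : Option (Fin (2 * Δ - 2))) :
    ∃ w α, F.parent w = some v ∧ c s(v, w) = some α ∧ o ≠ some α := by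
  have hcard := (h.blocked hdeg hb).1
  obtain ⟨α, hα, β, hβ, hne⟩ :=
    (Set.one_lt_ncard (Set.toFinite _)).1 (show 1 < (F.childColors c v).ncard by omega)
  by_cases ho : o = some α
  · obtain ⟨w, hw, hc⟩ := hβ
    exact ⟨w, β, hw, hc, fun h2 => hne (Option.some_injective _ (ho.symm.trans h2))⟩
  · obtain ⟨w, hw, hc⟩ := hα
    exact ⟨w, α, hw, hc, ho⟩

end Blocked

end Pending

/-! ### Termination -/

section Termination

variable [DecidableEq V] {Δ : ℕ}

theorem not_step_done {κ : ℕ} {c : PartialColoring V κ} {t : Config V κ} :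
    ¬ Step F (.done c) t := nofun

theorem eq_of_reflTransGen_done {κ : ℕ} {c : PartialColoring V κ} {t : Config V κ}
    (h : Relation.ReflTransGen (Step F) (.done c) t) : t = .done c := by
  rcases Relation.ReflTransGen.cases_head h with h | ⟨_, h, _⟩
  · exact h.symm
  · exact absurd h not_step_done

theorem acc_done {κ : ℕ} (c : PartialColoring V κ) :
    Acc (fun s t : Config V κ => Step F t s) (.done c) :=
  ⟨_, fun _ h => absurd h not_step_done⟩

/-- A step that does not finish leads to a pending call on a child edge. -/
theorem Pending.step {c : PartialColoring V (2 * Δ - 2)} {u v : V} (h : Pending F c u v)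
    (hdeg : F.DegreeLE Δ) {t : Config V (2 * Δ - 2)} (ht : Step F (.call c u v) t) :
    (∃ c', t = .done c') ∨ ∃ c' w, F.parent w = some v ∧ t = .call c' v w ∧ Pending F c' v w := by
  cases ht with
  | finish hα => exact Or.inl ⟨_, rfl⟩
  | @lookAhead _ _ _ w α huv hw =>
    exact Or.inr ⟨_, w, hw.1, rfl, h.shift hw.1 hw.2.1 hw.2.2.1⟩
  | @descend _ _ _ w α huv hno hw hα hne =>
    refine Or.inr ⟨_, w, hw, rfl, h.shift hw hα ?_⟩
    rw [← (h.blocked hdeg huv).2]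
    exact ⟨w, hw, hα⟩

theorem Pending.acc [Finite V] (hdeg : F.DegreeLE Δ) {v : V} :
    ∀ {u : V} {c : PartialColoring V (2 * Δ - 2)}, Pending F c u v →
      Acc (fun s t : Config V (2 * Δ - 2) => Step F t s) (.call c u v) := by
  induction v using F.wellFounded_child.induction with
  | _ v ih =>
    intro u c h
    refine ⟨_, fun t ht => ?_⟩
    rcases h.step hdeg ht with ⟨c', rfl⟩ | ⟨c', w, hw, rfl, h'⟩
    · exact acc_done c'
    · exact ih w hw h'

/-- A blocked vertex `v` has `Δ - 1 ≥ 2` child edges, so one of them avoids the forbidden color. -/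
theorem Pending.exists_step {c : PartialColoring V (2 * Δ - 2)} {u v : V} (h : Pending F c u v)
    (hdeg : F.DegreeLE Δ) (hΔ : 3 ≤ Δ) : ∃ t, Step F (.call c u v) t := by
  by_cases hb : F.available c u ∩ F.available c v = ∅
  · by_cases hl : ∃ w α, LookAhead F c u v w α
    · obtain ⟨w, α, hw⟩ := hl
      exact ⟨_, .lookAhead hb hw⟩
    · obtain ⟨w, α, hw, hα, hne⟩ := h.exists_child_ne hdeg hΔ hb (F.grandColor c u)
      exact ⟨_, .descend hb (fun w α hw => hl ⟨w, α, hw⟩) hw hα hne⟩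
  · obtain ⟨α, hα⟩ := Set.nonempty_iff_ne_empty.2 hb
    exact ⟨_, .finish hα⟩

theorem Pending.eq_done_of_stuck {c : PartialColoring V (2 * Δ - 2)} {u v : V}
    (h : Pending F c u v) (hdeg : F.DegreeLE Δ) (hΔ : 3 ≤ Δ) {s : Config V (2 * Δ - 2)}
    (hs : Relation.ReflTransGen (Step F) (.call c u v) s) (hstuck : ∀ t, ¬ Step F s t) :
    ∃ c', s = .done c' := by
  have hinv : (∃ c', s = .done c') ∨ ∃ c' u' v', s = .call c' u' v' ∧ Pending F c' u' v' := by
    clear hstuck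
    induction hs with
    | refl => exact Or.inr ⟨c, u, v, rfl, h⟩
    | @tail s t _ hst ih =>
      rcases ih with ⟨c', rfl⟩ | ⟨c', u', v', rfl, h'⟩
      · exact absurd hst not_step_done
      · rcases h'.step hdeg hst with ht | ⟨c', w, _, rfl, h'⟩
        · exact Or.inl ht
        · exact Or.inr ⟨_, _, _, rfl, h'⟩
  rcases hinv with hs | ⟨c', u', v', rfl, h'⟩
  · exact hs
  · obtain ⟨t, ht⟩ := h'.exists_step hdeg hΔ
    exact absurd ht (hstuck t)

end Termination

/-! ### The cost of handling one insertion -/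

section Run

variable [DecidableEq V]

/-- What a completed run from the pending call on `(u, v)` has done to the coloring `c`. Only edges
below `v` are recolored; if the call could not finish at once, `(u, v)` has received the old color
of a child edge of `v`; and, but for one, the recolored edges are paid for by the vertices of `M`,
which were locked and no longer are. At most three vertices become locked. -/
structure RunSpec {κ : ℕ} (F : RootedForest V) (c : PartialColoring V κ) (u v : V)
    (c' : PartialColoring V κ) : Prop where
  isProper : F.IsProper c'
  eq_of_ne : ∀ e, e ≠ s(u, v) → (∀ a b, F.parent b = some a → F.Below a v → e ≠ s(a, b)) →
    c' e = c e
  color_mem : F.available c u ∩ F.available c v = ∅ → ∃ β ∈ F.childColors c v, c' s(u, v) = some β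
  cost : ∃ (M : Finset V) (z : V),
    {e | e ∈ F.graph.edgeSet ∧ e ≠ s(u, v) ∧ c e ≠ c' e}.ncard ≤ M.card + 1 ∧
    (∀ x ∈ M, F.Below x v ∧ F.Locked c x ∧ ¬ F.Locked c' x) ∧
    ∀ x, F.Locked c' x → F.Locked c x ∨ x = u ∨ F.parent u = some x ∨ x = z

theorem RunSpec.finish {κ : ℕ} {c : PartialColoring V κ} {u v : V} (h : Pending F c u v)
    {α : Fin κ} (hα : α ∈ F.available c u ∩ F.available c v) :
    RunSpec F c u v (Function.update c s(u, v) (some α)) where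
  isProper := h.isProper_update hα
  eq_of_ne e he _ := Function.update_of_ne he _ _
  color_mem hb := absurd hα (by simp [hb])
  cost := by
    refine ⟨∅, u, ?_, by simp, fun x hx => ?_⟩
    · have : {e | e ∈ F.graph.edgeSet ∧ e ≠ s(u, v) ∧
          c e ≠ Function.update c s(u, v) (some α) e} = ∅ := by
        refine Set.eq_empty_of_forall_notMem fun e he => he.2.2 ?_
        rw [Function.update_of_ne he.2.1]
      rw [this]
      simp
    · by_cases hxu : x = u
      · exact Or.inr (Or.inl hxu)
      by_cases hpx : F.parent u = some x
      · exact Or.inr (Or.inr (Or.inl hpx))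
      refine Or.inl ((locked_iff_of_childColors_eq (Z := {u}) ?_ hxu ?_).1 hx)
      · exact fun y hy => childColors_update h.parent hy _
      · rintro z rfl
        exact hpx

/-- A shift only affects whether `u`, `v` and the parent of `u` are locked. -/
theorem Pending.locked_shift_iff {κ : ℕ} {c : PartialColoring V κ} {u v : V} (h : Pending F c u v)
    {w : V} {α : Fin κ} (hw : F.parent w = some v) {x : V} (hxu : x ≠ u) (hxv : x ≠ v)
    (hpx : F.parent u ≠ some x) : F.Locked (ColorfulPath.shift c u v w α) x ↔ F.Locked c x := by
  refine locked_iff_of_childColors_eq (Z := {u, v}) ?_ ?_ ?_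
  · intro y hy
    exact h.shift_childColors hw (fun hyu => hy (Or.inl hyu)) (fun hyv => hy (Or.inr hyv))
  · rintro (h1 | h1)
    · exact hxu h1
    · exact hxv h1
  · rintro z (rfl | rfl)
    · exact hpx
    · rw [h.parent]
      exact fun h1 => hxu (Option.some_injective _ h1).symm

theorem RunSpec.shift_eq_of_ne {κ : ℕ} {c c' : PartialColoring V κ} {u v w : V} {α : Fin κ}
    (hw : F.parent w = some v) (ih : RunSpec F (ColorfulPath.shift c u v w α) v w c') {e : Sym2 V}
    (he : e ≠ s(u, v)) (hb : ∀ a b, F.parent b = some a → F.Below a v → e ≠ s(a, b)) :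
    c' e = c e := by
  have hvw : e ≠ s(v, w) := hb v w hw Relation.ReflTransGen.refl
  rw [ih.eq_of_ne e hvw fun a b hab ha => hb a b hab (ha.tail hw), ColorfulPath.shift,
    Function.update_of_ne hvw, Function.update_of_ne he]

theorem RunSpec.shift_apply {κ : ℕ} {c c' : PartialColoring V κ} {u v w : V} {α : Fin κ}
    (hv : F.parent v = some u) (hw : F.parent w = some v)
    (ih : RunSpec F (ColorfulPath.shift c u v w α) v w c') : c' s(u, v) = some α := by
  have hne : s(u, v) ≠ s(v, w) := fun he =>
    ne_of_parent hv (eq_of_sym2_eq hv hw he).1.symm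
  rw [ih.eq_of_ne _ hne, ColorfulPath.shift, Function.update_of_ne hne, Function.update_self]
  intro a b hab ha he
  obtain ⟨rfl, rfl⟩ := eq_of_sym2_eq hv hab he
  exact not_below_of_parent_parent hv hw ha

/-- A shift does not change the set of colors seen by the middle vertex. -/
theorem Pending.available_shift {κ : ℕ} {c : PartialColoring V κ} {u v w : V} {α : Fin κ}
    (h : Pending F c u v) (hw : F.parent w = some v) (hα : c s(v, w) = some α) :
    F.available (ColorfulPath.shift c u v w α) v = F.available c v := by
  have hne : s(u, v) ≠ s(v, w) := fun he =>
    ne_of_parent h.parent (eq_of_sym2_eq h.parent hw he).1.symm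
  have hvw : ColorfulPath.shift c u v w α s(v, w) = none := by simp [ColorfulPath.shift]
  have huv : ColorfulPath.shift c u v w α s(v, u) = some α := by
    rw [Sym2.eq_swap, ColorfulPath.shift, Function.update_of_ne hne, Function.update_self]
  have hvu : c s(v, u) = none := by rw [Sym2.eq_swap, h.uncolored]
  have hother : ∀ y, y ≠ u → y ≠ w → ColorfulPath.shift c u v w α s(v, y) = c s(v, y) := by
    intro y hyu hyw
    rw [ColorfulPath.shift, Function.update_of_ne fun he => hyw (Sym2.congr_right.1 he),
      Function.update_of_ne fun he => hyu (Sym2.congr_right.1 (he.trans Sym2.eq_swap))]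
  ext β
  constructor
  · intro hβ y hy
    by_cases hyu : y = u
    · rw [hyu, hvu]
      simp
    by_cases hyw : y = w
    · rw [hyw, hα, ← huv]
      exact hβ u (Or.inl h.parent)
    rw [← hother y hyu hyw]
    exact hβ y hy
  · intro hβ y hy
    by_cases hyu : y = u
    · rw [hyu, huv, ← hα]
      exact hβ w (Or.inr hw)
    by_cases hyw : y = w
    · rw [hyw, hvw]
      simp
    rw [hother y hyu hyw]
    exact hβ y hy

theorem Pending.available_shift_child {κ : ℕ} {c : PartialColoring V κ} {u v w : V} {α : Fin κ}
    (h : Pending F c u v) (hw : F.parent w = some v) (hα : c s(v, w) = some α)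
    (hu : α ∈ F.available c u) :
    F.available (ColorfulPath.shift c u v w α) w = (F.childColors c w)ᶜ := by
  rw [← h.shift_childColors hw (ne_of_parent_parent h.parent hw) (ne_of_parent hw),
    ← (h.shift hw hα hu).compl_available_eq, compl_compl]

/-- After a shift to an edge that can be colored, the next step finishes. -/
theorem RunSpec.lookAhead {κ : ℕ} {c c' : PartialColoring V κ} {u v w : V} {α : Fin κ}
    (h : Pending F c u v) (hw : LookAhead F c u v w α)
    (hrun : Relation.ReflTransGen (Step F) (.call (ColorfulPath.shift c u v w α) v w) (.done c')) :
    RunSpec F c u v c' := by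
  obtain ⟨hwv, hα, hu, β, hβw, hβv⟩ := hw
  have h' := h.shift hwv hα hu
  have hβ : β ∈ F.available (ColorfulPath.shift c u v w α) v ∩
      F.available (ColorfulPath.shift c u v w α) w := by
    rw [h.available_shift hwv hα, h.available_shift_child hwv hα hu]
    refine ⟨hβv, ?_⟩
    rintro ⟨y, hy, hc⟩
    exact hβw y (Or.inr hy) hc
  obtain ⟨γ, hγ, rfl⟩ : ∃ γ, γ ∈ F.available (ColorfulPath.shift c u v w α) v ∩
      F.available (ColorfulPath.shift c u v w α) w ∧
      c' = Function.update (ColorfulPath.shift c u v w α) s(v, w) (some γ) := by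
    rcases Relation.ReflTransGen.cases_head hrun with h1 | ⟨t, ht, hrun⟩
    · cases h1
    · cases ht with
      | @finish _ _ _ γ hγ =>
        exact ⟨γ, hγ, (Config.done.inj (eq_of_reflTransGen_done hrun))⟩
      | lookAhead huv => exact absurd hβ (by simp [huv])
      | descend huv => exact absurd hβ (by simp [huv])
  have ih := RunSpec.finish h' hγ
  refine ⟨ih.isProper, fun e => ih.shift_eq_of_ne hwv, fun _ => ⟨α, ⟨w, hwv, hα⟩,
    ih.shift_apply h.parent hwv⟩, ∅, v, ?_, by simp, fun x hx => ?_⟩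
  · refine (Set.ncard_le_ncard (t := {s(v, w)}) ?_ (Set.toFinite _)).trans (by simp)
    rintro e ⟨-, he, hne⟩
    by_contra hvw
    rw [Function.update_of_ne hvw, ColorfulPath.shift, Function.update_of_ne hvw,
      Function.update_of_ne he] at hne
    exact hne rfl
  · by_cases hxu : x = u
    · exact Or.inr (Or.inl hxu)
    by_cases hpx : F.parent u = some x
    · exact Or.inr (Or.inr (Or.inl hpx))
    by_cases hxv : x = v
    · exact Or.inr (Or.inr (Or.inr hxv))
    refine Or.inl ((h.locked_shift_iff (α := α) hwv hxu hxv hpx).1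
      ((locked_iff_of_childColors_eq (Z := {v}) ?_ hxv ?_).1 hx))
    · exact fun y hy => childColors_update h'.parent hy _
    · rintro z rfl hz
      exact hxu (Option.some_injective _ (hz.symm.trans h.parent))

variable {Δ : ℕ}

/-- A blind step at `v`, towards the child `w`, is paid for by `v`. Before it, `v` is locked. It
cannot be followed by a finishing step, so the edge to `w` finally gets the color of a child edge
of `w`. This color also occurs below every other child of `v`, so `v` is no longer locked. -/
theorem RunSpec.descend [Finite V] {c c' : PartialColoring V (2 * Δ - 2)} {u v w : V}
    {α : Fin (2 * Δ - 2)} (hdeg : F.DegreeLE Δ) (hΔ : 3 ≤ Δ) (h : Pending F c u v)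
    (hb : F.available c u ∩ F.available c v = ∅) (hno : ∀ w' α', ¬ LookAhead F c u v w' α')
    (hw : F.parent w = some v) (hα : c s(v, w) = some α)
    (ih : RunSpec F (ColorfulPath.shift c u v w α) v w c') : RunSpec F c u v c' := by
  have hu : α ∈ F.available c u := (h.blocked hdeg hb).2 ▸ ⟨w, hw, hα⟩
  have hcc : ∀ y, y ≠ u → y ≠ v →
      F.childColors (ColorfulPath.shift c u v w α) y = F.childColors c y :=
    fun y => h.shift_childColors hw
  have hwu := ne_of_parent_parent h.parent hw
  have hwv := ne_of_parent hw
  have hlocked : F.Locked c v := ⟨⟨w, hw⟩, fun y hy => h.childColors_eq hdeg hb hno hy⟩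
  -- the next call is blocked again
  have hb' : F.available (ColorfulPath.shift c u v w α) v ∩
      F.available (ColorfulPath.shift c u v w α) w = ∅ := by
    rw [h.available_shift hw hα, h.available_shift_child hw hα hu, hlocked.2 w hw,
      ← h.compl_available_eq, compl_compl, Set.inter_compl_self]
  have hunlocked : ¬ F.Locked c' v := by
    intro hl
    obtain ⟨β, hβ, hβ'⟩ := ih.color_mem hb'
    -- a second child `y` of `v`, whose child edges the run does not touch
    obtain ⟨y, γ, hy, hγ, hne⟩ := h.exists_child_ne hdeg hΔ hb (some α)
    have hyw : y ≠ w := by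
      rintro rfl
      exact hne (hα.symm.trans hγ)
    have hyu := ne_of_parent_parent h.parent hy
    have hyv := ne_of_parent hy
    have hyc : F.childColors c' y = F.childColors c w := by
      rw [hlocked.2 w hw, ← hlocked.2 y hy, ← hcc y hyu hyv]
      refine childColors_congr fun z hz => ih.eq_of_ne _ ?_ ?_
      · exact fun he => hyv (eq_of_sym2_eq hz hw he).1
      · rintro a b hab ha he
        obtain ⟨rfl, rfl⟩ := eq_of_sym2_eq hz hab he
        rcases Relation.ReflTransGen.cases_head ha with h1 | ⟨x, hx, hxw⟩
        · exact hyw h1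
        · obtain rfl : v = x := Option.some_injective _ (hy.symm.trans hx)
          exact not_below_of_parent hw hxw
    have h1 : β ∈ F.childColors c' y := by
      rw [hyc, ← hcc w hwu hwv]
      exact hβ
    rw [hl.2 y hy] at h1
    exact h1 ⟨w, hw, hβ'⟩
  refine ⟨ih.isProper, fun e => ih.shift_eq_of_ne hw, fun _ => ⟨α, ⟨w, hw, hα⟩,
    ih.shift_apply h.parent hw⟩, ?_⟩
  obtain ⟨M, z, hcost, hM, hz⟩ := ih.cost
  have hbelow : ∀ x, F.Below x w → x ≠ u ∧ x ≠ v ∧ F.parent u ≠ some x := by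
    intro x hx
    have hwv' : Relation.TransGen (fun a b => F.parent a = some b) w v := .single hw
    have hwu' : Relation.TransGen (fun a b => F.parent a = some b) w u := hwv'.tail h.parent
    refine ⟨?_, ?_, fun hp => ?_⟩
    · rintro rfl
      exact F.acyclic w (hwu'.trans_left hx)
    · rintro rfl
      exact F.acyclic w (hwv'.trans_left hx)
    · exact F.acyclic w ((hwu'.tail hp).trans_left hx)
  have hvM : v ∉ M := fun hv => (hbelow v (hM v hv).1).2.1 rfl
  refine ⟨insert v M, z, ?_, ?_, fun x hx => ?_⟩
  · rw [Finset.card_insert_of_notMem hvM]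
    refine (Set.ncard_le_ncard (t := insert s(v, w) {e | e ∈ F.graph.edgeSet ∧ e ≠ s(v, w) ∧
      ColorfulPath.shift c u v w α e ≠ c' e}) ?_ (Set.toFinite _)).trans
      ((Set.ncard_insert_le _ _).trans (by omega))
    rintro e ⟨he, heuv, hne⟩
    by_cases hvw : e = s(v, w)
    · exact Or.inl hvw
    · refine Or.inr ⟨he, hvw, ?_⟩
      rwa [ColorfulPath.shift, Function.update_of_ne hvw, Function.update_of_ne heuv]
  · intro x hx
    rcases Finset.mem_insert.1 hx with rfl | hx
    · exact ⟨Relation.ReflTransGen.refl, hlocked, hunlocked⟩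
    · obtain ⟨hxw, hxl, hxl'⟩ := hM x hx
      obtain ⟨hxu, hxv, hpx⟩ := hbelow x hxw
      exact ⟨hxw.tail hw, (h.locked_shift_iff hw hxu hxv hpx).1 hxl, hxl'⟩
  · have hxv : x ≠ v := by
      rintro rfl
      exact hunlocked hx
    by_cases hxu : x = u
    · exact Or.inr (Or.inl hxu)
    by_cases hpx : F.parent u = some x
    · exact Or.inr (Or.inr (Or.inl hpx))
    rcases hz x hx with h1 | h1 | h1 | h1
    · exact Or.inl ((h.locked_shift_iff hw hxu hxv hpx).1 h1)
    · exact absurd h1 hxv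
    · exact absurd (Option.some_injective _ (h1.symm.trans h.parent)) hxu
    · exact Or.inr (Or.inr (Or.inr h1))

theorem Pending.runSpec [Finite V] (hdeg : F.DegreeLE Δ) (hΔ : 3 ≤ Δ) {v : V} :
    ∀ {u : V} {c c' : PartialColoring V (2 * Δ - 2)}, Pending F c u v →
      Relation.ReflTransGen (Step F) (.call c u v) (.done c') → RunSpec F c u v c' := by
  induction v using F.wellFounded_child.induction with
  | _ v ih =>
    intro u c c' h hrun
    rcases Relation.ReflTransGen.cases_head hrun with h1 | ⟨t, ht, hrun⟩
    · cases h1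
    · cases ht with
      | finish hα =>
        obtain rfl := Config.done.inj (eq_of_reflTransGen_done hrun)
        exact .finish h hα
      | lookAhead huv hw => exact .lookAhead h hw hrun
      | @descend _ _ _ w α huv hno hw hα hne =>
        have hu : α ∈ F.available c u := (h.blocked hdeg huv).2 ▸ ⟨w, hw, hα⟩
        exact .descend hdeg hΔ h huv hno hw hα (ih w hw (h.shift hw hα hu) hrun)

end Run

/-! ### The amortized bound -/

section Amortized

variable [DecidableEq V] {Δ : ℕ}

/-- The potential: the number of locked vertices. -/
noncomputable def lockedCount {κ : ℕ} (F : RootedForest V) (c : PartialColoring V κ) : ℕ :=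
  {v | F.Locked c v}.ncard

theorem adj_insert {p r : V} (h : F.CanInsert p r) {x y : V}
    (hxy : (F.update (.insert p r)).graph.Adj x y) : F.graph.Adj x y ∨ s(x, y) = s(p, r) := by
  rcases hxy with hxy | hxy <;> rcases (parent_insert_iff h).1 hxy with hxy | ⟨rfl, rfl⟩
  · exact Or.inl (Or.inl hxy)
  · exact Or.inr Sym2.eq_swap
  · exact Or.inl (Or.inr hxy)
  · exact Or.inr rfl

theorem Pending.of_insert {κ : ℕ} {c : PartialColoring V κ} (hc : F.IsProper c) {p r : V}
    (h : F.CanInsert p r) :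
    Pending (F.update (.insert p r)) (Function.update c s(p, r) none) p r := by
  have hcol : ∀ x y, (F.update (.insert p r)).graph.Adj x y → s(x, y) ≠ s(p, r) →
      Function.update c s(p, r) none s(x, y) ≠ none := by
    intro x y hxy he
    rw [Function.update_of_ne he]
    exact hc.1 s(x, y) ((adj_insert h hxy).resolve_right he)
  refine ⟨(parent_insert_iff h).2 (Or.inr ⟨rfl, rfl⟩), by simp, fun e => ?_,
    fun x y z hy hz hyz => ?_⟩
  · induction e with
    | _ x y => exact hcol x y
  · by_cases h1 : s(x, y) = s(p, r)
    · have h2 : s(x, z) ≠ s(p, r) := fun h2 => hyz (Sym2.congr_right.1 (h1.trans h2.symm))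
      have h3 := hcol x z hz h2
      rw [h1, Function.update_self]
      exact h3.symm
    by_cases h2 : s(x, z) = s(p, r)
    · have h3 := hcol x y hy h1
      rw [h2, Function.update_self]
      exact h3
    rw [Function.update_of_ne h1, Function.update_of_ne h2]
    exact hc.2 x y z ((adj_insert h hy).resolve_right h1) ((adj_insert h hz).resolve_right h2) hyz

/-- The new edge is still uncolored, so its insertion changes no child colors. -/
theorem locked_of_locked_insert {κ : ℕ} {c : PartialColoring V κ} {p r : V}
    (h : F.CanInsert p r) {x : V} (hxp : x ≠ p)
    (hx : (F.update (.insert p r)).Locked (Function.update c s(p, r) none) x) :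
    F.Locked c x := by
  have hcc : ∀ y, (F.update (.insert p r)).childColors (Function.update c s(p, r) none) y =
      F.childColors c y := by
    intro y
    ext α
    refine exists_congr fun w => ?_
    rw [parent_insert_iff h]
    by_cases he : s(y, w) = s(p, r)
    · have hyw : F.parent w ≠ some y := fun hyw =>
        not_adj_of_canInsert h (by
          rw [← SimpleGraph.mem_edgeSet, ← he]
          exact Or.inr hyw)
      simp [he, hyw]
    · rw [Function.update_of_ne he]
      refine and_congr_left fun _ => or_iff_left ?_
      rintro ⟨rfl, rfl⟩
      exact he rfl
  have hpar : ∀ w, (F.update (.insert p r)).parent w = some x ↔ F.parent w = some x := fun w => by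
    rw [parent_insert_iff h, or_iff_left fun h1 => hxp h1.1]
  simpa only [Locked, hcc, hpar] using hx

/-- One recolored edge and at most three newly locked vertices (`p`, its parent, and the vertex
where the run ends) are not paid for by vertices that cease to be locked. -/
theorem insert_bound [Finite V] (hΔ : 3 ≤ Δ) {c c' : PartialColoring V (2 * Δ - 2)}
    (hc : F.IsProper c) {p r : V} (h : F.Legal Δ (.insert p r))
    (hrun : Relation.ReflTransGen (Step (F.update (.insert p r))) (start c (.insert p r))
      (.done c')) :
    (F.update (.insert p r)).IsProper c' ∧
      F.recourse (F.update (.insert p r)) c c' + lockedCount (F.update (.insert p r)) c' ≤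
        lockedCount F c + 4 := by
  obtain ⟨hproper, -, -, M, z, hcost, hM, hz⟩ := (Pending.of_insert hc h.1).runSpec h.2 hΔ hrun
  refine ⟨hproper, ?_⟩
  have hrec : F.recourse (F.update (.insert p r)) c c' ≤ M.card + 1 := by
    refine (Set.ncard_le_ncard ?_ (Set.toFinite _)).trans hcost
    rintro e ⟨heF, heF', hne⟩
    have he : e ≠ s(p, r) := by
      rintro rfl
      exact not_adj_of_canInsert h.1 heF
    exact ⟨heF', he, by rwa [Function.update_of_ne he]⟩
  have hlock : ∀ x, (F.update (.insert p r)).Locked (Function.update c s(p, r) none) x →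
      x ∈ {v | F.Locked c v} ∪ {p} := by
    intro x hx
    by_cases hxp : x = p
    · exact Or.inr hxp
    · exact Or.inl (locked_of_locked_insert h.1 hxp hx)
  have hsub : {v | (F.update (.insert p r)).Locked c' v} ∪ (M : Set V) ⊆
      (({v | F.Locked c v} ∪ {p}) ∪ {v | (F.update (.insert p r)).parent p = some v}) ∪ {z} := by
    rintro x (hx | hx)
    · rcases hz x hx with h1 | h1 | h1 | h1
      · exact Or.inl (Or.inl (hlock x h1))
      · exact Or.inl (Or.inl (Or.inr h1))
      · exact Or.inl (Or.inr h1)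
      · exact Or.inr h1
    · exact Or.inl (Or.inl (hlock x (hM x hx).2.1))
  have hdisj : Disjoint {v | (F.update (.insert p r)).Locked c' v} (M : Set V) :=
    Set.disjoint_left.2 fun x hx hxM => (hM x hxM).2.2 hx
  have h1 := Set.ncard_le_ncard hsub (Set.toFinite _)
  rw [Set.ncard_union_eq hdisj (Set.toFinite _) (Set.toFinite _), Set.ncard_coe_finset] at h1
  have h2 := Set.ncard_union_le (({v | F.Locked c v} ∪ {p}) ∪
    {v | (F.update (.insert p r)).parent p = some v}) {z}
  have h3 := Set.ncard_union_le ({v | F.Locked c v} ∪ {p})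
    {v | (F.update (.insert p r)).parent p = some v}
  have h4 := Set.ncard_union_le {v | F.Locked c v} {p}
  have h5 : {v | (F.update (.insert p r)).parent p = some v}.ncard ≤ 1 :=
    (Set.ncard_le_one (Set.toFinite _)).2 fun a ha b hb => Option.some_injective _ (ha.symm.trans hb)
  simp only [Set.ncard_singleton] at h2 h4
  simp only [lockedCount]
  omega

/-- A deletion recolors nothing, and only `p` and its parent can become locked. -/
theorem delete_bound [Finite V] {κ : ℕ} {c : PartialColoring V κ}
    (hc : F.IsProper c) {p r : V} (h : F.parent r = some p) :
    (F.update (.delete p r)).IsProper (Function.update c s(p, r) none) ∧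
      F.recourse (F.update (.delete p r)) c (Function.update c s(p, r) none) +
        lockedCount (F.update (.delete p r)) (Function.update c s(p, r) none) ≤
        lockedCount F c + 2 := by
  have hpar : ∀ x y, (F.update (.delete p r)).parent y = some x ↔
      F.parent y = some x ∧ s(x, y) ≠ s(p, r) := by
    intro x y
    rw [parent_delete_iff h]
    refine and_congr_right fun hy => not_congr ⟨?_, fun he => (eq_of_sym2_eq hy h he).2⟩
    rintro rfl
    rw [Option.some_injective _ (h.symm.trans hy)]
  have hedge : ∀ e, e ∈ (F.update (.delete p r)).graph.edgeSet →
      e ∈ F.graph.edgeSet ∧ e ≠ s(p, r) := by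
    intro e he
    obtain ⟨a, b, hab, rfl⟩ := mem_edgeSet_iff.1 he
    obtain ⟨h1, h2⟩ := (hpar a b).1 hab
    exact ⟨mem_edgeSet_iff.2 ⟨a, b, h1, rfl⟩, h2⟩
  have hcol : ∀ e, e ∈ (F.update (.delete p r)).graph.edgeSet →
      Function.update c s(p, r) none e = c e := fun e he => Function.update_of_ne (hedge e he).2 _ _
  refine ⟨⟨fun e he => ?_, fun x y z hy hz hyz => ?_⟩, ?_⟩
  · rw [hcol e he]
    exact hc.1 e (hedge e he).1
  · rw [hcol s(x, y) hy, hcol s(x, z) hz]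
    exact hc.2 x y z (hedge s(x, y) hy).1 (hedge s(x, z) hz).1 hyz
  have hrec : F.recourse (F.update (.delete p r)) c (Function.update c s(p, r) none) = 0 := by
    have : {e | e ∈ F.graph.edgeSet ∧ e ∈ (F.update (.delete p r)).graph.edgeSet ∧
        c e ≠ Function.update c s(p, r) none e} = ∅ :=
      Set.eq_empty_of_forall_notMem fun e he => he.2.2 (hcol e he.2.1).symm
    simp [recourse, this]
  have hpar' : ∀ x y, x ≠ p → ((F.update (.delete p r)).parent y = some x ↔
      F.parent y = some x) := by
    intro x y hx
    rw [hpar]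
    exact and_iff_left_of_imp fun hxy he => hx (eq_of_sym2_eq hxy h he).1
  have hcc : ∀ y, y ≠ p → (F.update (.delete p r)).childColors (Function.update c s(p, r) none) y =
      F.childColors c y := by
    intro y hy
    rw [← childColors_update (c := c) h hy none]
    ext α
    exact exists_congr fun w => and_congr_left fun _ => hpar' y w hy
  have hsub : {v | (F.update (.delete p r)).Locked (Function.update c s(p, r) none) v} ⊆
      ({v | F.Locked c v} ∪ {p}) ∪ {v | F.parent p = some v} := by
    intro x hx
    by_cases hxp : x = p
    · exact Or.inl (Or.inr hxp)
    by_cases hpx : F.parent p = some x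
    · exact Or.inr hpx
    obtain ⟨⟨w, hw⟩, hx⟩ := hx
    refine Or.inl (Or.inl ⟨⟨w, (hpar' x w hxp).1 hw⟩, fun y hy => ?_⟩)
    have hyp : y ≠ p := by
      rintro rfl
      exact hpx hy
    rw [← hcc y hyp, ← hcc x hxp]
    exact hx y ((hpar' x y hxp).2 hy)
  have h1 := Set.ncard_le_ncard hsub (Set.toFinite _)
  have h2 := Set.ncard_union_le ({v | F.Locked c v} ∪ {p}) {v | F.parent p = some v}
  have h3 := Set.ncard_union_le {v | F.Locked c v} {p}
  have h4 : {v | F.parent p = some v}.ncard ≤ 1 :=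
    (Set.ncard_le_one (Set.toFinite _)).2 fun a ha b hb => Option.some_injective _ (ha.symm.trans hb)
  simp only [Set.ncard_singleton] at h3
  simp only [hrec, lockedCount]
  omega

/-- The recourse plus the potential grows by at most 4 per update. -/
theorem Run.bound [Finite V] (hΔ : 3 ≤ Δ) {h : UpdateHistory V}
    {c : PartialColoring V (2 * Δ - 2)} {R : ℕ} (hrun : Run Δ h c R) :
    (RootedForest.after h).IsProper c ∧
      R + lockedCount (RootedForest.after h) c ≤ 4 * h.length := by
  induction hrun with
  | nil =>
    have h1 : ∀ u v : V, ¬ (RootedForest.after ([] : UpdateHistory V)).graph.Adj u v := by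
      rintro u v (h1 | h1) <;> cases h1
    refine ⟨⟨fun e => ?_, fun u v w huv => absurd huv (h1 u v)⟩, ?_⟩
    · induction e with
      | _ u v => exact fun he => absurd he (h1 u v)
    · have : {v : V | (RootedForest.after []).Locked (κ := 2 * Δ - 2) (fun _ => none) v} = ∅ := by
        refine Set.eq_empty_of_forall_notMem ?_
        rintro v ⟨⟨w, hw⟩, -⟩
        cases hw
      simp [lockedCount, this]
  | @cons h c c' R x _ hx hstep ih =>
    obtain ⟨hc, hR⟩ := ih
    cases x with
    | insert p r =>
      obtain ⟨h1, h2⟩ := insert_bound hΔ hc hx hstep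
      refine ⟨h1, ?_⟩
      simp only [List.length_cons]
      simp only [RootedForest.after] at h1 ⊢
      omega
    | delete p r =>
      obtain rfl := Config.done.inj (eq_of_reflTransGen_done hstep)
      obtain ⟨h1, h2⟩ := delete_bound hc hx
      refine ⟨h1, ?_⟩
      simp only [List.length_cons]
      simp only [RootedForest.after] at h1 ⊢
      omega

theorem terminates [Finite V] (hΔ : 3 ≤ Δ) {c : PartialColoring V (2 * Δ - 2)}
    (hc : F.IsProper c) {x : ForestUpdate V} (hx : F.Legal Δ x) :
    Terminates (F.update x) c x := by
  cases x with
  | insert p r =>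
    have h := Pending.of_insert hc hx.1
    exact ⟨h.acc hx.2, fun s hs hstuck => h.eq_done_of_stuck hx.2 hΔ hs hstuck⟩
  | delete p r =>
    exact ⟨acc_done _, fun s hs _ => ⟨_, eq_of_reflTransGen_done hs⟩⟩

end Amortized

end ColorfulPath

namespace ForcedRecoloring

open RootedForest

/-! ### Stars and posts -/

/-- The vertices of the lower bound construction: the centers of `N` stars, their `d` leaves each,
and one post for every set of colors. -/
abbrev Site (N d κ : ℕ) : Type := Fin N ⊕ (Fin N × Fin d) ⊕ Finset (Fin κ)

section Board

variable {V : Type*} {N d κ : ℕ}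

/-- The center of the star `i`. -/
abbrev center (f : Site N d κ ↪ V) (i : Fin N) : V := f (.inl i)

/-- The leaf `j` of the star `i`. -/
abbrev leaf (f : Site N d κ ↪ V) (i : Fin N) (j : Fin d) : V := f (.inr (.inl (i, j)))

/-- The post of the set `S` of colors. -/
abbrev post (f : Site N d κ ↪ V) (S : Finset (Fin κ)) : V := f (.inr (.inr S))

/-- The edges of `F` are the legs of the stars that belong to `T`, and, for every star `i` with
`σ i = some S`, an edge that makes its center a child of the post of `S`. -/
def IsBoard (f : Site N d κ ↪ V) (T : Finset (Fin N × Fin d)) (σ : Fin N → Option (Finset (Fin κ)))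
    (F : RootedForest V) : Prop :=
  ∀ a b, F.parent b = some a ↔
    (∃ i j, (i, j) ∈ T ∧ a = center f i ∧ b = leaf f i j) ∨
      ∃ i S, σ i = some S ∧ a = post f S ∧ b = center f i

variable {f : Site N d κ ↪ V} {T : Finset (Fin N × Fin d)}
  {σ : Fin N → Option (Finset (Fin κ))} {F : RootedForest V}

theorem IsBoard.parent_leaf (h : IsBoard f T σ F) {i : Fin N} {j : Fin d} (hij : (i, j) ∈ T) :
    F.parent (leaf f i j) = some (center f i) :=
  (h _ _).2 (Or.inl ⟨i, j, hij, rfl, rfl⟩)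

theorem IsBoard.parent_center (h : IsBoard f T σ F) {i : Fin N} {S : Finset (Fin κ)}
    (hi : σ i = some S) : F.parent (center f i) = some (post f S) :=
  (h _ _).2 (Or.inr ⟨i, S, hi, rfl, rfl⟩)

theorem IsBoard.parent_post (h : IsBoard f T σ F) (S : Finset (Fin κ)) :
    F.parent (post f S) = none := by
  refine Option.eq_none_iff_forall_ne_some.2 fun a ha => ?_
  rcases (h _ _).1 ha with ⟨i, j, -, -, he⟩ | ⟨i, S', -, -, he⟩ <;> simp at he

theorem IsBoard.parent_center_eq_none (h : IsBoard f T σ F) {i : Fin N} (hi : σ i = none) :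
    F.parent (center f i) = none := by
  refine Option.eq_none_iff_forall_ne_some.2 fun a ha => ?_
  rcases (h _ _).1 ha with ⟨i', j, -, -, he⟩ | ⟨i', S', hi', -, he⟩
  · simp at he
  · simp only [EmbeddingLike.apply_eq_iff_eq, Sum.inl.injEq] at he
    subst he
    rw [hi] at hi'
    cases hi'

theorem IsBoard.parent_leaf_eq_none (h : IsBoard f T σ F) {i : Fin N} {j : Fin d}
    (hij : (i, j) ∉ T) : F.parent (leaf f i j) = none := by
  refine Option.eq_none_iff_forall_ne_some.2 fun a ha => ?_
  rcases (h _ _).1 ha with ⟨i', j', hT, -, he⟩ | ⟨i', S', -, -, he⟩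
  · simp only [EmbeddingLike.apply_eq_iff_eq, Sum.inr.injEq, Sum.inl.injEq] at he
    exact hij (he ▸ hT)
  · simp at he

theorem canInsert_of_root {p r : V} (hp : F.parent p = none) (hr : F.parent r = none)
    (hpr : p ≠ r) : F.CanInsert p r := by
  refine ⟨hr, fun hb => ?_⟩
  rcases Relation.ReflTransGen.cases_head hb with h1 | ⟨x, hx, -⟩
  · exact hpr h1
  · rw [hp] at hx
    cases hx

theorem IsBoard.degreeLE (h : IsBoard f T σ F)
    (hσ : ∀ S, {i | σ i = some S}.encard ≤ (d + 1 : ℕ)) : F.DegreeLE (d + 1) := by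
  intro x
  have hle : (F.graph.neighborSet x).encard ≤
      {a | F.parent x = some a}.encard + {b | F.parent b = some x}.encard :=
    (Set.encard_le_encard fun y hy => hy).trans (Set.encard_union_le _ _)
  have hpar : {a | F.parent x = some a}.encard ≤ 1 :=
    Set.encard_le_one_iff.2 fun a b ha hb => Option.some_injective _ (ha.symm.trans hb)
  refine hle.trans ?_
  by_cases hpost : ∃ S, x = post f S
  · obtain ⟨S, rfl⟩ := hpost
    have h1 : {a | F.parent (post f S) = some a} = ∅ := by
      simp [h.parent_post S]
    rw [h1, Set.encard_empty, zero_add]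
    refine le_trans (le_trans (Set.encard_le_encard (t := center f '' {i | σ i = some S}) ?_)
      (Set.encard_image_le _ _)) (hσ S)
    intro b hb
    rcases (h _ _).1 hb with ⟨i, j, -, he, -⟩ | ⟨i, S', hi, he, rfl⟩
    · simp at he
    · simp only [EmbeddingLike.apply_eq_iff_eq, Sum.inr.injEq] at he
      exact ⟨i, he ▸ hi, rfl⟩
  · have hch : {b | F.parent b = some x}.encard ≤ d := by
      by_cases hcenter : ∃ i, x = center f i
      · obtain ⟨i, rfl⟩ := hcenter
        refine (Set.encard_le_encard (t := leaf f i '' Set.univ) ?_).trans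
          ((Set.encard_image_le _ _).trans (by simp))
        intro b hb
        rcases (h _ _).1 hb with ⟨i', j, -, he, rfl⟩ | ⟨i', S', -, he, -⟩
        · simp only [EmbeddingLike.apply_eq_iff_eq, Sum.inl.injEq] at he
          exact ⟨j, trivial, by rw [he]⟩
        · simp at he
      · have : {b | F.parent b = some x} = ∅ := by
          refine Set.eq_empty_of_forall_notMem fun b hb => ?_
          rcases (h _ _).1 hb with ⟨i', j, -, he, -⟩ | ⟨i', S', -, he, -⟩
          · exact hcenter ⟨i', he⟩
          · exact hpost ⟨S', he⟩
        simp [this]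
    calc _ ≤ (1 : ℕ∞) + d := add_le_add hpar hch
      _ = ((d + 1 : ℕ) : ℕ∞) := by rw [add_comm]; norm_cast

variable [DecidableEq V]

theorem IsBoard.insert_leg (h : IsBoard f T σ F) {i : Fin N} {j : Fin d}
    (hc : F.CanInsert (center f i) (leaf f i j)) :
    IsBoard f (insert (i, j) T) σ (F.update (.insert (center f i) (leaf f i j))) := by
  intro a b
  rw [parent_insert_iff hc, h]
  constructor
  · rintro ((⟨i', j', hT, h1⟩ | h1) | ⟨rfl, rfl⟩)
    · exact Or.inl ⟨i', j', Finset.mem_insert_of_mem hT, h1⟩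
    · exact Or.inr h1
    · exact Or.inl ⟨i, j, Finset.mem_insert_self _ _, rfl, rfl⟩
  · rintro (⟨i', j', hT, h1⟩ | h1)
    · rcases Finset.mem_insert.1 hT with he | hT
      · obtain ⟨rfl, rfl⟩ := Prod.mk.inj he
        exact Or.inr h1
      · exact Or.inl (Or.inl ⟨i', j', hT, h1⟩)
    · exact Or.inl (Or.inr h1)

theorem IsBoard.insert_center (h : IsBoard f T σ F) {i : Fin N} {S : Finset (Fin κ)}
    (hi : σ i = none) (hc : F.CanInsert (post f S) (center f i)) :
    IsBoard f T (Function.update σ i (some S)) (F.update (.insert (post f S) (center f i))) := by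
  intro a b
  rw [parent_insert_iff hc, h]
  constructor
  · rintro ((h1 | ⟨i', S', hi', h1⟩) | ⟨rfl, rfl⟩)
    · exact Or.inl h1
    · refine Or.inr ⟨i', S', ?_, h1⟩
      rwa [Function.update_of_ne]
      rintro rfl
      rw [hi] at hi'
      cases hi'
    · exact Or.inr ⟨i, S, by simp, rfl, rfl⟩
  · rintro (h1 | ⟨i', S', hi', h1⟩)
    · exact Or.inl (Or.inl h1)
    · by_cases he : i' = i
      · subst he
        obtain rfl : S = S' := by simpa using hi'
        exact Or.inr h1
      · rw [Function.update_of_ne he] at hi'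
        exact Or.inl (Or.inr ⟨i', S', hi', h1⟩)

theorem IsBoard.delete_center (h : IsBoard f T σ F) {i : Fin N} {S : Finset (Fin κ)}
    (hi : σ i = some S) :
    IsBoard f T (Function.update σ i none) (F.update (.delete (post f S) (center f i))) := by
  intro a b
  rw [parent_delete_iff (h.parent_center hi), h]
  constructor
  · rintro ⟨h1 | ⟨i', S', hi', ha, rfl⟩, hne⟩
    · exact Or.inl h1
    · refine Or.inr ⟨i', S', ?_, ha, rfl⟩
      rwa [Function.update_of_ne]
      rintro rfl
      exact hne rfl
  · rintro (⟨i', j', hT, ha, rfl⟩ | ⟨i', S', hi', ha, rfl⟩)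
    · exact ⟨Or.inl ⟨i', j', hT, ha, rfl⟩, by simp⟩
    · by_cases he : i' = i
      · subst he
        simp at hi'
      · rw [Function.update_of_ne he] at hi'
        exact ⟨Or.inr ⟨i', S', hi', ha, rfl⟩, by simpa using he⟩

/-- Any set of legs can be built from the forest without edges. -/
theorem exists_isBoard (f : Site N d κ ↪ V) (T : Finset (Fin N × Fin d)) :
    ∃ h : UpdateHistory V, LegalHistory (d + 1) h ∧ IsBoard f T (fun _ => none) (after h) := by
  induction T using Finset.induction_on with
  | empty =>
    refine ⟨[], trivial, fun a b => ?_⟩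
    simp [after, RootedForest.empty]
  | @insert ij T hij ih =>
    obtain ⟨h, hlegal, hb⟩ := ih
    obtain ⟨i, j⟩ := ij
    have hc : (after h).CanInsert (center f i) (leaf f i j) :=
      canInsert_of_root (hb.parent_center_eq_none rfl) (hb.parent_leaf_eq_none hij) (by simp)
    have hb' := hb.insert_leg hc
    exact ⟨.insert (center f i) (leaf f i j) :: h,
      ⟨hlegal, hc, hb'.degreeLE (by simp)⟩, hb'⟩

end Board

/-! ### Forcing recolorings -/

section Adversary

variable {V : Type*} {N d κ : ℕ} {f : Site N d κ ↪ V}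
  {σ : Fin N → Option (Finset (Fin κ))} {F F' : RootedForest V} {c c' : PartialColoring V κ}

open Classical in
/-- The colors of the legs of the star `i`. -/
noncomputable def legColors (f : Site N d κ ↪ V) (c : PartialColoring V κ) (i : Fin N) :
    Finset (Fin κ) :=
  {α | ∃ j, c s(center f i, leaf f i j) = some α}

/-- The stars that hang on a post but whose legs do not have the colors that belong to the post. -/
def spoiled (f : Site N d κ ↪ V) (c : PartialColoring V κ) (σ : Fin N → Option (Finset (Fin κ))) :
    Set (Fin N) :=
  {i | ∃ S, σ i = some S ∧ S ≠ legColors f c i}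

theorem mem_legColors {i : Fin N} {α : Fin κ} :
    α ∈ legColors f c i ↔ ∃ j, c s(center f i, leaf f i j) = some α := by
  simp [legColors]

/-- The colors of the legs of a star can only change if a leg is recolored. -/
theorem ncard_legColors_ne_le [Finite V] (hF : IsBoard f Finset.univ σ F)
    {σ' : Fin N → Option (Finset (Fin κ))} (hF' : IsBoard f Finset.univ σ' F') :
    {i | legColors f c i ≠ legColors f c' i}.ncard ≤ F.recourse F' c c' := by
  have hex : ∀ i ∈ {i | legColors f c i ≠ legColors f c' i},
      ∃ j, c s(center f i, leaf f i j) ≠ c' s(center f i, leaf f i j) := by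
    intro i hi
    by_contra! hall
    refine hi (Finset.ext fun α => ?_)
    simp only [mem_legColors, hall]
  rcases Set.eq_empty_or_nonempty {i | legColors f c i ≠ legColors f c' i} with hN | ⟨i₀, hi₀⟩
  · simp [hN]
  have : Nonempty (Fin d) := ⟨(hex i₀ hi₀).choose⟩
  choose! j hj using hex
  refine Set.ncard_le_ncard_of_injOn (fun i => s(center f i, leaf f i (j i))) ?_ ?_
    (Set.toFinite _)
  · intro i hi
    exact ⟨Or.inr (hF.parent_leaf (Finset.mem_univ _)), Or.inr (hF'.parent_leaf (Finset.mem_univ _)),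
      hj i hi⟩
  · intro i _ i' _ he
    have := (eq_of_sym2_eq (hF.parent_leaf (Finset.mem_univ (i, j i)))
      (hF.parent_leaf (Finset.mem_univ (i', j i'))) he).1
    simpa using this

theorem card_legColors (hF : IsBoard f Finset.univ σ F) (hc : F.IsProper c) (i : Fin N) :
    (legColors f c i).card = d := by
  have hadj : ∀ j, F.graph.Adj (center f i) (leaf f i j) := fun j =>
    Or.inr (hF.parent_leaf (Finset.mem_univ _))
  choose g hg using fun j => Option.ne_none_iff_exists'.1 (hc.1 s(center f i, leaf f i j) (hadj j))
  have hinj : Function.Injective g := by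
    intro j j' he
    by_contra hne
    refine hc.2 _ _ _ (hadj j) (hadj j') (by simpa using hne) ?_
    rw [hg, hg, he]
  have : legColors f c i = Finset.univ.map ⟨g, hinj⟩ := by
    ext α
    simp [mem_legColors, hg]
  simp [this]

/-- On a post with the color set `S`, all edges to stars that are not spoiled are colored outside
`S`, so there is room for few of them. -/
theorem card_fiber_le (hκ : κ = 2 * d) (hF : IsBoard f Finset.univ σ F) (hc : F.IsProper c)
    (hgood : spoiled f c σ = ∅) (S : Finset (Fin κ)) : {i | σ i = some S}.ncard ≤ d := by
  by_cases hne : ∃ i₀, σ i₀ = some S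
  swap
  · have : {i | σ i = some S} = ∅ :=
      Set.eq_empty_of_forall_notMem fun i hi => hne ⟨i, hi⟩
    simp [this]
  obtain ⟨i₀, hi₀⟩ := hne
  have hS : ∀ i, σ i = some S → legColors f c i = S := by
    intro i hi
    by_contra h1
    exact (Set.ext_iff.1 hgood i).1 ⟨S, hi, fun h2 => h1 h2.symm⟩
  have hadj : ∀ i, σ i = some S → F.graph.Adj (post f S) (center f i) := fun i hi =>
    Or.inr (hF.parent_center hi)
  have hcol : ∀ i, σ i = some S → ∃ α, c s(post f S, center f i) = some α := fun i hi =>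
    Option.ne_none_iff_exists'.1 (hc.1 s(post f S, center f i) (hadj i hi))
  have : Nonempty (Fin κ) := ⟨(hcol i₀ hi₀).choose⟩
  choose! g hg using hcol
  have hcard : (Sᶜ).card = d := by
    rw [Finset.card_compl, ← hS i₀ hi₀, card_legColors hF hc, Fintype.card_fin]
    omega
  rw [← hcard, ← Set.ncard_coe_finset]
  refine Set.ncard_le_ncard_of_injOn g ?_ ?_ (Set.toFinite _)
  · intro i hi
    rw [Finset.mem_coe, Finset.mem_compl, ← hS i hi, mem_legColors]
    rintro ⟨j, hj⟩
    refine hc.2 (center f i) (post f S) (leaf f i j) (hadj i hi).symm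
      (Or.inr (hF.parent_leaf (Finset.mem_univ _))) (by simp) ?_
    rw [hj, Sym2.eq_swap, hg i hi]
  · intro i hi i' hi' he
    by_contra hne
    refine hc.2 _ _ _ (hadj i hi) (hadj i' hi') (by simpa using hne) ?_
    rw [hg i hi, hg i' hi', he]

/-- There are too many stars for the posts to hold them all without a spoiled one. -/
theorem exists_free_star (hκ : κ = 2 * d) (hN : 2 ^ κ * d < N) (hF : IsBoard f Finset.univ σ F)
    (hc : F.IsProper c) (hgood : spoiled f c σ = ∅) : ∃ i, σ i = none := by
  by_contra! hall
  choose g hg using fun i => Option.ne_none_iff_exists'.1 (hall i)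
  obtain ⟨S, hS⟩ := Fintype.exists_lt_card_fiber_of_mul_lt_card g (n := d) (by simpa using hN)
  have h1 := card_fiber_le hκ hF hc hgood S
  have h2 : {i | σ i = some S} = ((Finset.univ.filter fun i => g i = S : Finset (Fin N)) :
      Set (Fin N)) := by
    ext i
    simp [hg]
  rw [h2, Set.ncard_coe_finset] at h1
  omega

/-- One update of the adversary: take a spoiled star off its post, or, if there is none, hang a free
star on the post of its own leg colors. The number of hanging stars, minus twice the number of
spoiled ones, plus twice the recourse grows by at least one. -/
theorem exists_update [Finite V] [DecidableEq V] (hκ : κ = 2 * d) (hN : 2 ^ κ * d < N)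
    {A : DynamicColoringAlgorithm V κ} (hA : A.Maintains (d + 1)) {h : UpdateHistory V}
    (hlegal : LegalHistory (d + 1) h) (hF : IsBoard f Finset.univ σ (after h)) :
    ∃ (x : ForestUpdate V) (σ' : Fin N → Option (Finset (Fin κ))),
      LegalHistory (d + 1) (x :: h) ∧ IsBoard f Finset.univ σ' (after (x :: h)) ∧
      1 + {i | σ i ≠ none}.ncard + 2 * (spoiled f (A (x :: h)) σ').ncard ≤
        {i | σ' i ≠ none}.ncard + 2 * (spoiled f (A h) σ).ncard +
          2 * (after h).recourse (after (x :: h)) (A h) (A (x :: h)) := by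
  have hc := hA h hlegal
  by_cases hbad : spoiled f (A h) σ = ∅
  · obtain ⟨i, hi⟩ := exists_free_star hκ hN hF hc hbad
    set S := legColors f (A h) i with hS
    have hins : (after h).CanInsert (post f S) (center f i) :=
      canInsert_of_root (hF.parent_post S) (hF.parent_center_eq_none hi) (by simp)
    have hF' := hF.insert_center hi hins
    have hdeg : ∀ S', {i' | Function.update σ i (some S) i' = some S'}.encard ≤ (d + 1 : ℕ) := by
      intro S'
      rw [← (Set.toFinite _).cast_ncard_eq, Nat.cast_le]
      refine (Set.ncard_le_ncard (t := insert i {i' | σ i' = some S'}) ?_ (Set.toFinite _)).trans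
        ((Set.ncard_insert_le _ _).trans (Nat.succ_le_succ (card_fiber_le hκ hF hc hbad S')))
      intro i' hi'
      by_cases he : i' = i
      · exact Or.inl he
      · refine Or.inr ?_
        rwa [Set.mem_ofPred_eq, Function.update_of_ne he] at hi'
    refine ⟨.insert (post f S) (center f i), _, ⟨hlegal, hins, hF'.degreeLE hdeg⟩, hF', ?_⟩
    have h1 := ncard_legColors_ne_le (c := A h)
      (c' := A (.insert (post f S) (center f i) :: h)) hF hF'
    -- the new star is not spoiled at first, so every spoiled star has had a leg recolored
    have h2 : spoiled f (A (.insert (post f S) (center f i) :: h))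
        (Function.update σ i (some S)) ⊆ {i' | legColors f (A h) i' ≠
          legColors f (A (.insert (post f S) (center f i) :: h)) i'} := by
      rintro i' ⟨S', hi', hne⟩ he
      rw [← he] at hne
      by_cases hii : i' = i
      · subst hii
        rw [Function.update_self, Option.some.injEq] at hi'
        exact hne hi'.symm
      · rw [Function.update_of_ne hii] at hi'
        exact (Set.ext_iff.1 hbad i').1 ⟨S', hi', hne⟩
    have h3 := Set.ncard_le_ncard h2 (Set.toFinite _)
    have h4 : {i' | Function.update σ i (some S) i' ≠ none} = insert i {i' | σ i' ≠ none} := by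
      ext i'
      by_cases hii : i' = i
      · simp [hii]
      · simp [hii]
    rw [h4, Set.ncard_insert_of_notMem (by simp [hi]) (Set.toFinite _)]
    simp only [after] at h1 ⊢
    omega
  · obtain ⟨i, S, hi, hne⟩ := Set.nonempty_iff_ne_empty.2 hbad
    have hF' := hF.delete_center hi
    refine ⟨.delete (post f S) (center f i), _, ⟨hlegal, hF.parent_center hi⟩, hF', ?_⟩
    have h1 := ncard_legColors_ne_le (c := A h)
      (c' := A (.delete (post f S) (center f i) :: h)) hF hF'
    have h2 : spoiled f (A (.delete (post f S) (center f i) :: h)) (Function.update σ i none) ⊆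
        (spoiled f (A h) σ \ {i}) ∪ {i' | legColors f (A h) i' ≠
          legColors f (A (.delete (post f S) (center f i) :: h)) i'} := by
      rintro i' ⟨S', hi', hne'⟩
      have hii : i' ≠ i := by
        rintro rfl
        simp at hi'
      rw [Function.update_of_ne hii] at hi'
      by_cases he : legColors f (A h) i' =
          legColors f (A (.delete (post f S) (center f i) :: h)) i'
      · exact Or.inl ⟨⟨S', hi', he ▸ hne'⟩, hii⟩
      · exact Or.inr he
    have h3 := (Set.ncard_le_ncard h2 (Set.toFinite _)).trans (Set.ncard_union_le _ _)
    have h4 : (spoiled f (A h) σ \ {i}).ncard + 1 = (spoiled f (A h) σ).ncard :=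
      Set.ncard_sdiff_singleton_add_one ⟨S, hi, hne⟩ (Set.toFinite _)
    have h5 : {i' | Function.update σ i none i' ≠ none} = {i' | σ i' ≠ none} \ {i} := by
      ext i'
      by_cases hii : i' = i
      · simp [hii]
      · simp [hii]
    have h6 : ({i' | σ i' ≠ none} \ {i}).ncard + 1 = {i' | σ i' ≠ none}.ncard :=
      Set.ncard_sdiff_singleton_add_one (by simp [hi]) (Set.toFinite _)
    rw [h5]
    simp only [after] at h1 ⊢
    omega

/-- The adversary forces a total recourse of half the number of updates, up to a constant. -/
theorem exists_history [Finite V] [DecidableEq V] (hκ : κ = 2 * d) (hN : 2 ^ κ * d < N)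
    (f : Site N d κ ↪ V) {A : DynamicColoringAlgorithm V κ} (hA : A.Maintains (d + 1)) :
    ∃ U : ℕ, ∀ k : ℕ, ∃ h : UpdateHistory V, LegalHistory (d + 1) h ∧ h.length = U + k ∧
      k ≤ N + 2 * A.totalRecourse h := by
  obtain ⟨h₀, hlegal₀, hF₀⟩ := exists_isBoard f Finset.univ
  refine ⟨h₀.length, fun k => ?_⟩
  suffices hk : ∃ (h : UpdateHistory V) (σ : Fin N → Option (Finset (Fin κ))),
      LegalHistory (d + 1) h ∧ IsBoard f Finset.univ σ (after h) ∧ h.length = h₀.length + k ∧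
      k + 2 * (spoiled f (A h) σ).ncard ≤ {i | σ i ≠ none}.ncard + 2 * A.totalRecourse h by
    obtain ⟨h, σ, hlegal, -, hlen, hR⟩ := hk
    have h1 : {i | σ i ≠ none}.ncard ≤ N := by
      have := Set.ncard_le_card {i | σ i ≠ none}
      simpa using this
    exact ⟨h, hlegal, hlen, by omega⟩
  induction k with
  | zero => exact ⟨h₀, _, hlegal₀, hF₀, rfl, by simp [spoiled]⟩
  | succ k ih =>
    obtain ⟨h, σ, hlegal, hF, hlen, hR⟩ := ih
    obtain ⟨x, σ', hlegal', hF', hx⟩ := exists_update hκ hN hA hlegal hF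
    refine ⟨x :: h, σ', hlegal', hF', by simp [hlen, add_assoc], ?_⟩
    simp only [DynamicColoringAlgorithm.totalRecourse]
    omega

end Adversary

end ForcedRecoloring

theorem mainTheorem5 :
    -- upper bound, with an absolute constant `C`
    (∃ C : ℝ, ∀ (Δ : ℕ), 3 ≤ Δ → ∀ (n : ℕ) (h : UpdateHistory (Fin n))
        (c : PartialColoring (Fin n) (2 * Δ - 2)) (R : ℕ), ColorfulPath.Run Δ h c R →
          (RootedForest.after h).IsProper c ∧
          (R : ℝ) ≤ C * (h.length : ℝ) ∧
          ∀ x : ForestUpdate (Fin n), RootedForest.Legal Δ (RootedForest.after h) x →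
            ColorfulPath.Terminates (RootedForest.after (x :: h)) c x) ∧
    -- matching lower bound for every deterministic algorithm
    (∀ (Δ : ℕ), 3 ≤ Δ → ∃ n₀ : ℕ, ∀ n : ℕ, n₀ ≤ n →
      ∀ A : DynamicColoringAlgorithm (Fin n) (2 * Δ - 2),
        DynamicColoringAlgorithm.Maintains Δ A →
        ∀ ε : ℝ, 0 < ε → ∀ N : ℕ, ∃ h : UpdateHistory (Fin n),
          RootedForest.LegalHistory Δ h ∧ N ≤ h.length ∧
          (1 / 2 - ε) * (h.length : ℝ) < (A.totalRecourse h : ℝ)) := by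
  refine ⟨⟨4, fun Δ hΔ n h c R hrun => ?_⟩, fun Δ hΔ => ?_⟩
  · obtain ⟨hc, hR⟩ := hrun.bound hΔ
    refine ⟨hc, ?_, fun x hx => ColorfulPath.terminates hΔ hc hx⟩
    exact_mod_cast (Nat.le_add_right _ _).trans hR
  · obtain ⟨d, rfl⟩ : ∃ d, Δ = d + 1 := ⟨Δ - 1, by omega⟩
    refine ⟨Fintype.card (ForcedRecoloring.Site (2 ^ (2 * (d + 1) - 2) * d + 1) d
      (2 * (d + 1) - 2)), fun n hn A hA ε hε N => ?_⟩
    obtain ⟨f⟩ := Function.Embedding.nonempty_of_card_le (hn.trans (Fintype.card_fin n).ge)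
    obtain ⟨U, hU⟩ := ForcedRecoloring.exists_history (by omega) (Nat.lt_succ_self _) f hA
    set M := 2 ^ (2 * (d + 1) - 2) * d + 1
    -- beyond this length, the loss from the setup and the hanging stars is below `ε` per update
    obtain ⟨K, hK⟩ := exists_nat_gt (((U : ℝ) + M) / (2 * ε))
    obtain ⟨h, hlegal, hlen, hR⟩ := hU (N + K)
    refine ⟨h, hlegal, by omega, ?_⟩
    rw [div_lt_iff₀ (by positivity)] at hK
    have hR' : (N : ℝ) + K ≤ M + 2 * A.totalRecourse h := by exact_mod_cast hR
    have hlen' : (h.length : ℝ) = U + (N + K) := by exact_mod_cast hlen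
    have hpos : 0 ≤ ε * ((U : ℝ) + N) := by positivity
    rw [hlen']
    linarith
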